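/- For positive integers $q,r$ let $K_{q\times r}$ be the complete multipartite graph with $q$ parts, each of size $r$, and for $k\ge 1$ let $P_k$ be the path of length $k$ (with $k$ edges and $k+1$ distinct vertices). A $P_k$-decomposition of a graph $K$ is a set of subgraphs of $K$ (called blocks), each isomorphic to $P_k$, whose edge sets partition the edge set of $K$. If the vertex set of $K$ is $\mathbb{Z}_v$, where $v=|V(K)|$, a decomposition $\mathcal{D}$ of $K$ is called cyclic if $B+1\in\mathcal{D}$ for every $B\in\mathcal{D}$, where $B+1$ is obtained from $B$ by applying $x\mapsto x+1$ to its vertices and edges. Two decompositions $\mathcal{D}$ and $\mathcal{D}'$ of $K$ are orthogonal if $|E(B)\cap E(B')|\le 1$ for all $B\in\mathcal{D}$ and $B'\in\mathcal{D}'$. **Theorem.** Let $n\ge 1$ be an odd integer and let $t\ge 1$ be a divisor of $n$. Then the vertices of $K_{\frac{2n^2+t}{t}\times t}$ can be identified with the elements of $\mathbb{Z}_{2n^2+t}$ in such a way that there exist two orthogonal $P_n$-decompositions of $K_{\frac{2n^2+t}{t}\times t}$ which are both cyclic with respect to this identification. -/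

import Mathlib

/-- A `Γ`-decomposition of the graph `K`: a set `D` of subgraphs of `K` (the blocks), each isomorphic
to `Γ`, such that every edge of `K` lies in exactly one block. -/
structure IsGraphDecomposition {V W : Type*} (Γ : SimpleGraph W) (K : SimpleGraph V)
    (D : Set K.Subgraph) : Prop where
  block_iso : ∀ B ∈ D, Nonempty (B.coe ≃g Γ)
  edge_partition : ∀ e ∈ K.edgeSet, ∃! B : K.Subgraph, B ∈ D ∧ e ∈ B.edgeSet

/-- The permutation `x ↦ x + 1` of a vertex set `V` that is identified with `ℤ/v` through `φ`. -/
def shiftPerm {V : Type*} {v : ℕ} (φ : V ≃ ZMod v) : Equiv.Perm V :=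
  (φ.trans (Equiv.addRight (1 : ZMod v))).trans φ.symm

/-- A set of subgraphs of `K` is cyclic, with respect to the identification `φ` of the vertices of `K`
with `ℤ/v`, if for each member `B` the translate `B + 1` (vertices `x + 1` for `x` a vertex of `B`,
edges `{x + 1, y + 1}` for `{x, y}` an edge of `B`) is a member too. -/
def IsCyclicWith {V : Type*} {v : ℕ} (φ : V ≃ ZMod v) {K : SimpleGraph V}
    (D : Set K.Subgraph) : Prop :=
  ∀ B ∈ D, ∃ B' ∈ D, B'.verts = shiftPerm φ '' B.verts ∧
    ∀ x y : V, B'.Adj (shiftPerm φ x) (shiftPerm φ y) ↔ B.Adj x y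

/-- Two decompositions of `K` are orthogonal if a block of the first and a block of the second never
share more than one edge. -/
def AreOrthogonal {V : Type*} {K : SimpleGraph V} (D D' : Set K.Subgraph) : Prop :=
  ∀ B ∈ D, ∀ B' ∈ D', (B.edgeSet ∩ B'.edgeSet).encard ≤ 1

/-- `P_k`, the path of length `k`, with `k` edges and `k + 1` distinct vertices. -/
abbrev pathOfLength (k : ℕ) : SimpleGraph (Fin (k + 1)) := SimpleGraph.pathGraph (k + 1)

/-! Write v = 2n² + t and s = 2n²/t, and let the parts be the residue classes mod s + 1 in ℤ/v. As v
is odd, the differences between adjacent vertices are, up to sign, the integers below v/2 not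
divisible by s + 1: exactly n² numbers c₀ < c₁ < ⋯ (`two_mul_nonMultiple_lt_iff`). Put c_{ni+j} in
cell (i, j) of an n × n array, so that rows and columns both increase. The alternating sums of an
increasing sequence never repeat (`zigzag_sub_bounds`), so each row yields a base path, and so does
each column. All translates of the row paths form one cyclic decomposition, those of the column
paths another. A row and a column share a single cell, hence two blocks share at most one edge
(`areOrthogonal`). -/

open SimpleGraph

/-! ### Decompositions from difference families -/

/-- The translate by `g` of the path with vertices `p 0, …, p n` in `ℤ/v`, seen in `K` through `φ`. -/
def pathTranslate {V : Type*} {v : ℕ} (K : SimpleGraph V) (φ : V ≃ ZMod v) (n : ℕ)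
    (p : ℕ → ZMod v) (g : ZMod v) : K.Subgraph where
  verts := {x | ∃ j ≤ n, φ x = p j + g}
  Adj x y := K.Adj x y ∧ ∃ j < n, (φ x = p j + g ∧ φ y = p (j + 1) + g) ∨
    (φ y = p j + g ∧ φ x = p (j + 1) + g)
  adj_sub h := h.1
  edge_vert := by
    rintro x y ⟨-, j, hj, ⟨h, -⟩ | ⟨-, h⟩⟩
    · exact ⟨j, hj.le, h⟩
    · exact ⟨j + 1, hj, h⟩
  symm := by
    constructor
    rintro x y ⟨hK, j, hj, h⟩
    exact ⟨hK.symm, j, hj, h.symm⟩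

/-- A family of `n` base paths in `ℤ/v` of length `n` whose steps, up to sign, represent each
difference of adjacent vertices of `K` exactly once. -/
structure IsPathDifferenceFamily {V : Type*} {v : ℕ} (K : SimpleGraph V) (φ : V ≃ ZMod v) (n : ℕ)
    (p : ℕ → ℕ → ZMod v) : Prop where
  inj : ∀ i < n, ∀ j ≤ n, ∀ k ≤ n, p i j = p i k → j = k
  step_ne_neg : ∀ i < n, ∀ j < n, p i (j + 1) - p i j ≠ -(p i (j + 1) - p i j)
  step_unique : ∀ i < n, ∀ j < n, ∀ i' < n, ∀ j' < n,
    (p i (j + 1) - p i j = p i' (j' + 1) - p i' j' ∨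
      p i (j + 1) - p i j = -(p i' (j' + 1) - p i' j')) → i = i' ∧ j = j'
  adj_iff : ∀ x y, K.Adj x y ↔ ∃ i < n, ∃ j < n, φ y - φ x = p i (j + 1) - p i j ∨
    φ y - φ x = -(p i (j + 1) - p i j)

/-- All translates of the base paths. -/
def pathTranslates {V : Type*} {v : ℕ} (K : SimpleGraph V) (φ : V ≃ ZMod v) (n : ℕ)
    (p : ℕ → ℕ → ZMod v) : Set K.Subgraph :=
  {B | ∃ i < n, ∃ g, B = pathTranslate K φ n (p i) g}

section Family

variable {V : Type*} {v : ℕ} {K : SimpleGraph V} {φ : V ≃ ZMod v} {n : ℕ} {p : ℕ → ℕ → ZMod v}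

theorem pathTranslate_adj_step {q : ℕ → ZMod v} {g : ZMod v} {x y : V}
    (h : (pathTranslate K φ n q g).Adj x y) :
    ∃ j < n, (φ y - φ x = q (j + 1) - q j ∧ φ x = q j + g) ∨
      (φ y - φ x = -(q (j + 1) - q j) ∧ φ y = q j + g) := by
  obtain ⟨-, j, hj, ⟨h1, h2⟩ | ⟨h1, h2⟩⟩ := h
  · exact ⟨j, hj, .inl ⟨by rw [h1, h2]; ring, h1⟩⟩
  · exact ⟨j, hj, .inr ⟨by rw [h1, h2]; ring, h1⟩⟩

theorem IsPathDifferenceFamily.nonempty_iso (hp : IsPathDifferenceFamily K φ n p) {i : ℕ}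
    (hi : i < n) (g : ZMod v) :
    Nonempty ((pathTranslate K φ n (p i) g).coe ≃g pathOfLength n) := by
  have hinj : ∀ {j k : ℕ}, j ≤ n → k ≤ n → p i j + g = p i k + g → j = k :=
    fun hj hk h => hp.inj i hi _ hj _ hk (add_right_cancel h)
  let f : Fin (n + 1) → (pathTranslate K φ n (p i) g).verts := fun j =>
    ⟨φ.symm (p i j + g), j, Nat.lt_succ_iff.1 j.2, by simp⟩
  have hf : Function.Bijective f := by
    constructor
    · intro j k h
      have h' := φ.symm.injective (congrArg Subtype.val h)
      exact Fin.ext (hinj (Nat.lt_succ_iff.1 j.2) (Nat.lt_succ_iff.1 k.2) h')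
    · rintro ⟨x, j, hj, hx⟩
      exact ⟨⟨j, Nat.lt_succ_iff.2 hj⟩, Subtype.ext (by simp [f, ← hx])⟩
  refine ⟨RelIso.symm ⟨Equiv.ofBijective f hf, ?_⟩⟩
  intro a b
  have ha := Nat.lt_succ_iff.1 a.2
  have hb := Nat.lt_succ_iff.1 b.2
  simp only [Equiv.ofBijective_apply, SimpleGraph.pathGraph_adj, Subgraph.coe_adj]
  constructor
  · rintro ⟨-, j, hj, ⟨h1, h2⟩ | ⟨h1, h2⟩⟩ <;>
      simp only [f, Equiv.apply_symm_apply] at h1 h2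
    · left; rw [hinj ha hj.le h1, hinj hb hj h2]
    · right; rw [hinj hb hj.le h1, hinj ha hj h2]
  · rintro (h | h)
    · have hj : (a : ℕ) < n := by omega
      refine ⟨(hp.adj_iff _ _).2 ⟨i, hi, a, hj, .inl ?_⟩, a, hj, .inl ?_⟩ <;> simp [f, h]
    · have hj : (b : ℕ) < n := by omega
      refine ⟨(hp.adj_iff _ _).2 ⟨i, hi, b, hj, .inr ?_⟩, b, hj, .inr ?_⟩ <;> simp [f, h]

theorem IsPathDifferenceFamily.exists_adj (hp : IsPathDifferenceFamily K φ n p) {x y : V}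
    (h : K.Adj x y) : ∃ i < n, ∃ g, (pathTranslate K φ n (p i) g).Adj x y := by
  obtain ⟨i, hi, j, hj, h' | h'⟩ := (hp.adj_iff x y).1 h
  · exact ⟨i, hi, φ x - p i j, h, j, hj, .inl ⟨by ring, by linear_combination h'⟩⟩
  · exact ⟨i, hi, φ y - p i j, h, j, hj, .inr ⟨by ring, by linear_combination -h'⟩⟩

/-- The difference y - x, up to sign, determines the path and the step; since a step is not its own
negative, it also fixes the direction of travel, hence the translation. -/
theorem IsPathDifferenceFamily.adj_unique (hp : IsPathDifferenceFamily K φ n p) {x y : V}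
    {i i' : ℕ} (hi : i < n) (hi' : i' < n) {g g' : ZMod v}
    (h : (pathTranslate K φ n (p i) g).Adj x y) (h' : (pathTranslate K φ n (p i') g').Adj x y) :
    i = i' ∧ g = g' := by
  obtain ⟨j, hj, h⟩ := pathTranslate_adj_step h
  obtain ⟨j', hj', h'⟩ := pathTranslate_adj_step h'
  obtain ⟨rfl, rfl⟩ := hp.step_unique i hi j hj i' hi' j' hj' (by
    rcases h with ⟨h, -⟩ | ⟨h, -⟩ <;> rcases h' with ⟨h', -⟩ | ⟨h', -⟩
    · left; rw [← h, h']
    · right; rw [← h, h']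
    · right; rw [← h', h, neg_neg]
    · left; rw [← neg_inj, ← h, h'])
  refine ⟨rfl, ?_⟩
  have hne := hp.step_ne_neg i hi j hj
  rcases h with ⟨h, e⟩ | ⟨h, e⟩ <;> rcases h' with ⟨h', e'⟩ | ⟨h', e'⟩
  · exact add_left_cancel (e.symm.trans e')
  · exact absurd (h.symm.trans h') hne
  · exact absurd (h'.symm.trans h) hne
  · exact add_left_cancel (e.symm.trans e')

theorem IsPathDifferenceFamily.isGraphDecomposition (hp : IsPathDifferenceFamily K φ n p) :
    IsGraphDecomposition (pathOfLength n) K (pathTranslates K φ n p) where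
  block_iso := by
    rintro _ ⟨i, hi, g, rfl⟩
    exact hp.nonempty_iso hi g
  edge_partition := by
    intro e
    induction e using Sym2.ind with
    | _ x y =>
      intro h
      obtain ⟨i, hi, g, hg⟩ := hp.exists_adj h
      refine ⟨_, ⟨⟨i, hi, g, rfl⟩, hg⟩, ?_⟩
      rintro _ ⟨⟨i', hi', g', rfl⟩, hg'⟩
      obtain ⟨rfl, rfl⟩ := hp.adj_unique hi hi' hg hg'
      rfl

theorem IsPathDifferenceFamily.isCyclicWith (hp : IsPathDifferenceFamily K φ n p) :
    IsCyclicWith φ (pathTranslates K φ n p) := by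
  have hs : ∀ x, φ (shiftPerm φ x) = φ x + 1 := fun x => by simp [shiftPerm]
  have hK : ∀ x y, K.Adj (shiftPerm φ x) (shiftPerm φ y) ↔ K.Adj x y := fun x y => by
    simp only [hp.adj_iff, hs, add_sub_add_right_eq_sub]
  rintro _ ⟨i, hi, g, rfl⟩
  refine ⟨_, ⟨i, hi, g + 1, rfl⟩, ?_, ?_⟩
  · ext y
    obtain ⟨x, rfl⟩ := (shiftPerm φ).surjective y
    rw [(shiftPerm φ).injective.mem_set_image]
    simp only [pathTranslate, Set.mem_ofPred_eq, hs, ← add_assoc, add_left_inj]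
  · intro x y
    simp only [pathTranslate, hs, hK, ← add_assoc, add_left_inj]

/-- Two families are orthogonal if the step `j` of the path `i` of one is, up to sign, the step `i`
of the path `j` of the other. -/
theorem IsPathDifferenceFamily.areOrthogonal {p' : ℕ → ℕ → ZMod v}
    (hp : IsPathDifferenceFamily K φ n p)
    (h : ∀ i < n, ∀ j < n, p' j (i + 1) - p' j i = p i (j + 1) - p i j ∨
      p' j (i + 1) - p' j i = -(p i (j + 1) - p i j)) :
    AreOrthogonal (pathTranslates K φ n p) (pathTranslates K φ n p') := by
  rintro _ ⟨i, hi, g, rfl⟩ _ ⟨k, hk, g', rfl⟩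
  -- The only difference common to path `i` and path `k` is the one in cell (i, k), and it occurs on
  -- a single edge of the translate by `g`.
  have key : ∀ x y, (pathTranslate K φ n (p i) g).Adj x y →
      (pathTranslate K φ n (p' k) g').Adj x y →
      s(x, y) = s(φ.symm (p i k + g), φ.symm (p i (k + 1) + g)) := by
    intro x y h1 h2
    obtain ⟨j, hj, hxy⟩ := h1.2
    obtain ⟨j', hj', h2⟩ := pathTranslate_adj_step h2
    have hd : φ y - φ x = p i (j + 1) - p i j ∨ φ y - φ x = -(p i (j + 1) - p i j) := by
      rcases hxy with ⟨a, b⟩ | ⟨a, b⟩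
      · left; rw [a, b]; ring
      · right; rw [a, b]; ring
    have hd' : φ y - φ x = p j' (k + 1) - p j' k ∨ φ y - φ x = -(p j' (k + 1) - p j' k) := by
      rcases h2 with ⟨a, -⟩ | ⟨a, -⟩ <;> rcases h j' hj' k hk with b | b <;> rw [a, b] <;> simp
    have hjk : i = j' ∧ j = k := hp.step_unique i hi j hj j' hj' k hk (by
      rcases hd with a | a <;> rcases hd' with b | b
      · left; rw [← a, b]
      · right; rw [← a, b]
      · right; rw [← b, a, neg_neg]
      · left; rw [← neg_inj, ← a, b])
    obtain ⟨rfl, rfl⟩ := hjk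
    rcases hxy with ⟨a, b⟩ | ⟨a, b⟩
    · rw [← a, ← b]; simp
    · rw [← a, ← b, Sym2.eq_swap]; simp
  rw [Set.encard_le_one_iff]
  intro a b ha hb
  induction a using Sym2.ind with
  | _ x y =>
    induction b using Sym2.ind with
    | _ x' y' => rw [key x y ha.1 ha.2, key x' y' hb.1 hb.2]

end Family

/-! ### Zigzag paths from increasing sequences -/

/-- The partial sums `0, d 0, d 0 - d 1, d 0 - d 1 + d 2, …`. -/
def zigzag (d : ℕ → ℕ) (k : ℕ) : ℤ := ∑ j ∈ Finset.range k, (-1) ^ j * (d j : ℤ)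

theorem zigzag_succ_sub (d : ℕ → ℕ) (k : ℕ) :
    zigzag d (k + 1) - zigzag d k = (-1) ^ k * (d k : ℤ) := by
  simp [zigzag, Finset.sum_range_succ]

/-- Up to sign, each new difference is the latest step minus the previous difference, which is
positive and at most the previous, smaller step. -/
theorem zigzag_sub_bounds {d : ℕ → ℕ} (hd : StrictMono d) (h0 : ∀ k, 0 < d k) (i k : ℕ) :
    0 < (-1) ^ (i + k) * (zigzag d (i + k + 1) - zigzag d i) ∧
      (-1) ^ (i + k) * (zigzag d (i + k + 1) - zigzag d i) ≤ d (i + k) := by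
  have hsq : ∀ a : ℕ, ((-1 : ℤ) ^ a) * (-1) ^ a = 1 := fun a => by rw [← mul_pow]; simp
  induction k with
  | zero =>
    have := h0 i
    rw [add_zero, zigzag_succ_sub, ← mul_assoc, hsq]
    omega
  | succ k ih =>
    have e : (-1) ^ (i + (k + 1)) * (zigzag d (i + (k + 1) + 1) - zigzag d i) =
        (d (i + k + 1) : ℤ) - (-1) ^ (i + k) * (zigzag d (i + k + 1) - zigzag d i) := by
      have h1 := zigzag_succ_sub d (i + k + 1)
      have h2 := hsq (i + k)
      rw [← add_assoc, pow_succ]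
      rw [pow_succ] at h1
      linear_combination (-(-1) ^ (i + k)) * h1 + (d (i + k + 1) : ℤ) * h2
    have := hd (Nat.lt_succ_self (i + k))
    rw [e]
    simp only [Nat.succ_eq_add_one] at this
    rw [← add_assoc i k 1]
    omega

theorem zigzag_cast_inj {d : ℕ → ℕ} (hd : StrictMono d) (h0 : ∀ k, 0 < d k) {n v : ℕ}
    (hv : ∀ j < n, d j < v) {j k : ℕ} (hj : j ≤ n) (hk : k ≤ n)
    (h : ((zigzag d j : ℤ) : ZMod v) = (zigzag d k : ℤ)) : j = k := by
  wlog hjk : j < k generalizing j k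
  · rcases Nat.lt_trichotomy j k with h' | h' | h'
    · exact absurd h' hjk
    · exact h'
    · exact (this hk hj h.symm h').symm
  exfalso
  obtain ⟨l, rfl⟩ := Nat.exists_eq_add_of_lt hjk
  obtain ⟨h1, h2⟩ := zigzag_sub_bounds hd h0 j l
  have h3 := hv (j + l) (by omega)
  have h4 : (v : ℤ) ∣ (-1) ^ (j + l) * (zigzag d (j + l + 1) - zigzag d j) :=
    ((ZMod.intCast_eq_intCast_iff_dvd_sub _ _ _).1 h).mul_left _
  have := Int.le_of_dvd h1 h4
  omega

theorem natCast_eq_or_neg {v a b : ℕ} (ha : 0 < a) (ha' : 2 * a < v) (hb' : 2 * b < v)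
    (h : (a : ZMod v) = b ∨ (a : ZMod v) = -b) : a = b := by
  rcases h with h | h
  · rw [ZMod.natCast_eq_natCast_iff'] at h
    rwa [Nat.mod_eq_of_lt (by omega), Nat.mod_eq_of_lt (by omega)] at h
  · have : ((a + b : ℕ) : ZMod v) = 0 := by push_cast; rw [h]; ring
    rw [ZMod.natCast_eq_zero_iff] at this
    have := Nat.le_of_dvd (by omega) this
    omega

theorem zigzag_step_cast (d : ℕ → ℕ) (v k : ℕ) :
    ((zigzag d (k + 1) : ℤ) : ZMod v) - (zigzag d k : ℤ) = d k ∨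
      ((zigzag d (k + 1) : ℤ) : ZMod v) - (zigzag d k : ℤ) = -d k := by
  rw [← Int.cast_sub, zigzag_succ_sub]
  rcases neg_one_pow_eq_or ℤ k with h | h <;> simp [h]

theorem isPathDifferenceFamily_zigzag {V : Type*} {v : ℕ} {K : SimpleGraph V} {φ : V ≃ ZMod v}
    {n : ℕ} {d : ℕ → ℕ → ℕ} (hd : ∀ i, StrictMono (d i)) (h0 : ∀ i j, 0 < d i j)
    (hv : ∀ i < n, ∀ j < n, 2 * d i j < v)
    (hinj : ∀ i < n, ∀ j < n, ∀ i' < n, ∀ j' < n, d i j = d i' j' → i = i' ∧ j = j')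
    (hK : ∀ x y, K.Adj x y ↔ ∃ i < n, ∃ j < n, φ y - φ x = d i j ∨ φ y - φ x = -d i j) :
    IsPathDifferenceFamily K φ n (fun i j => ((zigzag (d i) j : ℤ) : ZMod v)) where
  inj i hi j hj k hk h :=
    zigzag_cast_inj (hd i) (h0 i) (fun j hj => by have := hv i hi j hj; omega) hj hk h
  step_ne_neg i hi j hj h := by
    have h1 : ((d i j : ℕ) : ZMod v) + d i j = 0 := by
      rcases zigzag_step_cast (d i) v j with e | e <;> rw [e] at h
      · linear_combination h
      · linear_combination -h
    rw [← Nat.cast_add, ZMod.natCast_eq_zero_iff] at h1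
    have := h0 i j
    have := hv i hi j hj
    have := Nat.le_of_dvd (by omega) h1
    omega
  step_unique i hi j hj i' hi' j' hj' h := by
    refine hinj i hi j hj i' hi' j' hj'
      (natCast_eq_or_neg (h0 i j) (hv i hi j hj) (hv i' hi' j' hj') ?_)
    rcases zigzag_step_cast (d i) v j with e | e <;>
      rcases zigzag_step_cast (d i') v j' with e' | e' <;> rw [e, e'] at h <;>
      simpa [neg_eq_iff_eq_neg, or_comm] using h
  adj_iff x y := by
    rw [hK]
    refine exists_congr fun i => and_congr_right fun _ => exists_congr fun j =>
      and_congr_right fun _ => ?_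
    rcases zigzag_step_cast (d i) v j with e | e <;> rw [e]
    rw [neg_neg, or_comm]

/-! ### Counting the admissible differences -/

/-- The `k`-th positive integer that is not a multiple of `s + 1`, counting from `0`. -/
def nonMultiple (s k : ℕ) : ℕ := k + 1 + k / s

theorem nonMultiple_strictMono (s : ℕ) : StrictMono (nonMultiple s) := by
  intro a b h
  have := Nat.div_le_div_right (c := s) h.le
  unfold nonMultiple
  omega

theorem nonMultiple_pos (s k : ℕ) : 0 < nonMultiple s k :=
  Nat.add_pos_left k.succ_pos _

theorem not_dvd_nonMultiple {s : ℕ} (hs : 0 < s) (k : ℕ) : ¬ (s + 1) ∣ nonMultiple s k := by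
  have h : nonMultiple s k = (k % s + 1) + (s + 1) * (k / s) := by
    have := Nat.div_add_mod k s
    unfold nonMultiple
    linarith
  have := Nat.mod_lt k hs
  rw [h, Nat.dvd_add_left (dvd_mul_right _ _)]
  exact Nat.not_dvd_of_pos_of_lt (by omega) (by omega)

theorem exists_nonMultiple_eq {s x : ℕ} (h : ¬ (s + 1) ∣ x) : ∃ k, nonMultiple s k = x := by
  have h1 := Nat.div_add_mod x (s + 1)
  have h2 : x % (s + 1) < s + 1 := Nat.mod_lt x (Nat.succ_pos s)
  have h3 : 0 < x % (s + 1) := Nat.pos_of_ne_zero fun h' => h (Nat.dvd_of_mod_eq_zero h')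
  -- Each full block of s + 1 integers contributes s non-multiples; the -1 is due to counting from
  -- 0.
  refine ⟨s * (x / (s + 1)) + (x % (s + 1) - 1), ?_⟩
  have h4 : (s * (x / (s + 1)) + (x % (s + 1) - 1)) / s = x / (s + 1) := by
    have hs : 0 < s := by omega
    have h5 : x % (s + 1) - 1 < s := by omega
    rw [Nat.mul_add_div hs, Nat.div_eq_of_lt h5, add_zero]
  rw [nonMultiple, h4]
  generalize x / (s + 1) = q at *
  rw [add_mul, one_mul] at h1
  omega

theorem two_mul_nonMultiple_lt_iff {s t N : ℕ} (hs : 0 < s) (ht : Odd t) (hN : s * t = 2 * N)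
    (k : ℕ) : 2 * nonMultiple s k < 2 * N + t ↔ k < N := by
  obtain ⟨u, rfl⟩ := ht
  -- With t = 2u + 1 this gives N / s = u, so the bound 2N + t lies strictly between 2(N + u) and
  -- 2(N + 1 + u), the latter being twice the `N`-th non-multiple.
  have hN' : 2 * N / s = 2 * u + 1 := by rw [← hN, Nat.mul_div_cancel_left _ hs]
  unfold nonMultiple
  constructor
  · intro h
    by_contra! hk
    have : N / s ≤ k / s := Nat.div_le_div_right hk
    have : u ≤ N / s := by rw [Nat.le_div_iff_mul_le hs]; nlinarith
    omega
  · intro h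
    have : k / s < u + 1 := by rw [Nat.div_lt_iff_lt_mul hs]; nlinarith
    omega

/-! ### The multipartite graph on ℤ/v and the n × n array -/

theorem exists_equiv_zmod {m t v : ℕ} [NeZero v] (h : v = m * t) :
    ∃ φ : Fin m × Fin t ≃ ZMod v, ∀ x, (φ x).val % m = x.1 := by
  -- For a successor modulus `ZMod` unfolds to `Fin`.
  obtain ⟨w, rfl⟩ := Nat.exists_eq_succ_of_ne_zero (NeZero.ne v)
  refine ⟨(Equiv.prodComm _ _).trans (finProdFinEquiv.trans (finCongr ((mul_comm t m).trans h.symm))), ?_⟩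
  intro x
  change (x.1.val + m * x.2.val) % m = x.1
  rw [Nat.add_mul_mod_self_left, Nat.mod_eq_of_lt x.1.2]

theorem exists_eq_natCast_or_neg {v : ℕ} [NeZero v] (hv : Odd v) (z : ZMod v) :
    ∃ a : ℕ, 2 * a < v ∧ (z = a ∨ z = -a) := by
  have h := z.val_lt
  rcases Nat.lt_or_ge (2 * z.val) v with h' | h'
  · exact ⟨z.val, h', .inl (by simp)⟩
  · refine ⟨v - z.val, ?_, .inr ?_⟩
    · obtain ⟨w, rfl⟩ := hv; omega
    · rw [Nat.cast_sub h.le]; simp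

/-- Vertices in different parts are those whose difference is, up to sign, one of the
`nonMultiple`s. -/
theorem equipartite_adj_iff {s t N : ℕ} (hs : 0 < s) (ht : Odd t) (hN : s * t = 2 * N)
    (φ : Fin (s + 1) × Fin t ≃ ZMod (2 * N + t)) (hφ : ∀ x, (φ x).val % (s + 1) = x.1)
    (x y : Fin (s + 1) × Fin t) :
    (completeEquipartiteGraph (s + 1) t).Adj x y ↔
      ∃ k < N, φ y - φ x = nonMultiple s k ∨ φ y - φ x = -nonMultiple s k := by
  have : NeZero (2 * N + t) := ⟨by obtain ⟨u, rfl⟩ := ht; omega⟩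
  have hm : s + 1 ∣ 2 * N + t := ⟨t, by rw [← hN]; ring⟩
  have hcast : ∀ x, ZMod.castHom hm (ZMod (s + 1)) (φ x) = ((x.1 : ℕ) : ZMod (s + 1)) := by
    intro x
    rw [← hφ x, ZMod.natCast_mod, ← map_natCast (ZMod.castHom hm (ZMod (s + 1))),
      ZMod.natCast_zmod_val]
  -- Reduction mod s + 1 is well defined on ℤ/v because s + 1 divides v.
  have hadj : (completeEquipartiteGraph (s + 1) t).Adj x y ↔
      ZMod.castHom hm (ZMod (s + 1)) (φ y - φ x) ≠ 0 := by
    rw [completeEquipartiteGraph_adj, map_sub, hcast, hcast, sub_ne_zero, not_iff_not,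
      ZMod.natCast_eq_natCast_iff', Nat.mod_eq_of_lt x.1.2, Nat.mod_eq_of_lt y.1.2, eq_comm,
      Fin.ext_iff]
  have hdvd : ∀ a : ℕ, φ y - φ x = a ∨ φ y - φ x = -a →
      (ZMod.castHom hm (ZMod (s + 1)) (φ y - φ x) ≠ 0 ↔ ¬ s + 1 ∣ a) := by
    rintro a (h | h) <;> rw [h] <;>
      simp only [map_neg, map_natCast, ne_eq, neg_eq_zero, ZMod.natCast_eq_zero_iff]
  rw [hadj]
  constructor
  · intro h
    obtain ⟨a, ha, h'⟩ :=
      exists_eq_natCast_or_neg (ht.add_even (even_two_mul N) |> (add_comm (2 * N) t ▸ ·))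
        (φ y - φ x)
    obtain ⟨k, rfl⟩ := exists_nonMultiple_eq ((hdvd a h').1 h)
    exact ⟨k, (two_mul_nonMultiple_lt_iff hs ht hN k).1 ha, h'⟩
  · rintro ⟨k, -, h⟩
    exact (hdvd _ h).2 (not_dvd_nonMultiple hs k)

theorem exists_orthogonal_cyclic_path_decompositions {n s t : ℕ} (hs : 0 < s) (ht : Odd t)
    (hN : s * t = 2 * n ^ 2) :
    ∃ (φ : Fin (s + 1) × Fin t ≃ ZMod (2 * n ^ 2 + t))
      (D D' : Set (completeEquipartiteGraph (s + 1) t).Subgraph),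
      IsGraphDecomposition (pathOfLength n) (completeEquipartiteGraph (s + 1) t) D ∧
      IsGraphDecomposition (pathOfLength n) (completeEquipartiteGraph (s + 1) t) D' ∧
      IsCyclicWith φ D ∧ IsCyclicWith φ D' ∧ AreOrthogonal D D' := by
  have : NeZero (2 * n ^ 2 + t) := ⟨by obtain ⟨u, rfl⟩ := ht; omega⟩
  obtain ⟨φ, hφ⟩ := exists_equiv_zmod (m := s + 1) (t := t) (v := 2 * n ^ 2 + t)
    (by rw [← hN]; ring)
  have hn : 0 < n := by
    have := Nat.mul_pos hs ht.pos
    exact Nat.pos_of_ne_zero (by rintro rfl; simp_all)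
  have hlt : ∀ i < n, ∀ j < n, n * i + j < n ^ 2 := fun i hi j hj => by nlinarith
  have hdiv : ∀ i, ∀ j < n, (n * i + j) / n = i := fun i j hj => by
    rw [Nat.mul_add_div hn, Nat.div_eq_of_lt hj, add_zero]
  have hidx : ∀ k < n ^ 2, ∃ i < n, ∃ j < n, n * i + j = k := fun k hk =>
    ⟨k / n, Nat.div_lt_of_lt_mul (by rwa [← sq]), k % n, Nat.mod_lt _ hn, Nat.div_add_mod k n⟩
  have hadj : ∀ x y, (completeEquipartiteGraph (s + 1) t).Adj x y ↔ ∃ i < n, ∃ j < n,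
      φ y - φ x = nonMultiple s (n * i + j) ∨ φ y - φ x = -nonMultiple s (n * i + j) := by
    intro x y
    rw [equipartite_adj_iff hs ht hN φ hφ]
    constructor
    · rintro ⟨k, hk, h⟩
      obtain ⟨i, hi, j, hj, rfl⟩ := hidx k hk
      exact ⟨i, hi, j, hj, h⟩
    · rintro ⟨i, hi, j, hj, h⟩
      exact ⟨_, hlt i hi j hj, h⟩
  have hv : ∀ i < n, ∀ j < n, 2 * nonMultiple s (n * i + j) < 2 * n ^ 2 + t :=
    fun i hi j hj => (two_mul_nonMultiple_lt_iff hs ht hN _).2 (hlt i hi j hj)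
  have hinj : ∀ i < n, ∀ j < n, ∀ i' < n, ∀ j' < n,
      nonMultiple s (n * i + j) = nonMultiple s (n * i' + j') → i = i' ∧ j = j' := by
    intro i _ j hj i' _ j' hj' h
    have h := (nonMultiple_strictMono s).injective h
    have hi : i = i' := by rw [← hdiv i j hj, h, hdiv i' j' hj']
    subst hi
    exact ⟨rfl, Nat.add_left_cancel h⟩
  have hrow := isPathDifferenceFamily_zigzag (d := fun i j => nonMultiple s (n * i + j))
    (fun i => (nonMultiple_strictMono s).comp fun a b h => Nat.add_lt_add_left h _)
    (fun _ _ => nonMultiple_pos _ _) hv hinj hadj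
  -- The transposed array: columns increase because consecutive entries are n > 0 places apart in
  -- the list.
  have hcol := isPathDifferenceFamily_zigzag (d := fun j i => nonMultiple s (n * i + j))
    (fun j => (nonMultiple_strictMono s).comp fun a b h =>
      Nat.add_lt_add_right (Nat.mul_lt_mul_of_pos_left h hn) _)
    (fun _ _ => nonMultiple_pos _ _) (fun j hj i hi => hv i hi j hj)
    (fun j hj i hi j' hj' i' hi' h => (hinj i hi j hj i' hi' j' hj' h).symm)
    (fun x y => (hadj x y).trans (by
      constructor <;> rintro ⟨i, hi, j, hj, h⟩ <;> exact ⟨j, hj, i, hi, h⟩))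
  refine ⟨φ, _, _, hrow.isGraphDecomposition, hcol.isGraphDecomposition, hrow.isCyclicWith,
    hcol.isCyclicWith, hrow.areOrthogonal fun i hi j hj => ?_⟩
  rcases zigzag_step_cast (fun j => nonMultiple s (n * i + j)) (2 * n ^ 2 + t) j with e | e <;>
    rcases zigzag_step_cast (fun i => nonMultiple s (n * i + j)) (2 * n ^ 2 + t) i with e' | e' <;>
    simp [e, e']

theorem mainTheorem7 (n t : ℕ) (hn : Odd n) (ht : t ∣ n) :
    ∃ (φ : Fin ((2 * n ^ 2 + t) / t) × Fin t ≃ ZMod (2 * n ^ 2 + t))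
      (D D' : Set (SimpleGraph.completeEquipartiteGraph ((2 * n ^ 2 + t) / t) t).Subgraph),
      IsGraphDecomposition (pathOfLength n)
        (SimpleGraph.completeEquipartiteGraph ((2 * n ^ 2 + t) / t) t) D ∧
      IsGraphDecomposition (pathOfLength n)
        (SimpleGraph.completeEquipartiteGraph ((2 * n ^ 2 + t) / t) t) D' ∧
      IsCyclicWith φ D ∧ IsCyclicWith φ D' ∧ AreOrthogonal D D' := by
  -- Oddness of t makes v odd, so nonzero differences pair off under negation.
  have hto : Odd t := hn.of_dvd_nat ht
  obtain ⟨s, hs⟩ : t ∣ 2 * n ^ 2 := (ht.trans (dvd_pow_self n two_ne_zero)).mul_left 2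
  have hs0 : 0 < s := Nat.pos_of_ne_zero (by
    rintro rfl
    have := pow_pos hn.pos 2
    omega)
  have hm : (2 * n ^ 2 + t) / t = s + 1 := by
    rw [hs, Nat.add_div_right _ hto.pos, Nat.mul_div_cancel_left _ hto.pos]
  rw [hm]
  exact exists_orthogonal_cyclic_path_decompositions hs0 hto (by rw [hs, mul_comm])
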